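/- Let $G=(V,E)$ be a finite simple graph, and let $I_G(t)=\sum_{j=0}^{d} i_j t^j$ be its independence polynomial, where $i_j$ is the number of independent sets of $G$ with $j$ elements and $d$ is the largest size of an independent set. For a map $\alpha\colon V\to\mathbb N=\{0,1,2,\dots\}$, a proper multicoloring of type $\alpha$ is a map $\kappa$ that assigns to each vertex $v$ a set $\kappa(v)$ of $\alpha(v)$ positive integers such that $\kappa(u)\cap\kappa(v)=\emptyset$ whenever $uv\in E$. Define the formal power series in countably many variables $$X_G^\alpha=\sum_\kappa x_1^{a_1(\kappa)}x_2^{a_2(\kappa)}\cdots,\qquad Y_G=\sum_{\alpha\colon V\to\mathbb N}X_G^\alpha,$$ where $\kappa$ ranges over the proper multicolorings of type $\alpha$ and $a_i(\kappa)$ is the number of vertices $v$ with $i\in\kappa(v)$. The series $Y_G$ has a unique expansion $Y_G=\sum_\lambda c_\lambda s_\lambda$ with rational coefficients, over all integer partitions $\lambda$, in the Schur functions $s_\lambda$ (an infinite sum, understood in each degree separately). Write $[s_\lambda]Y_G=c_\lambda$. Then the following conditions are equivalent: 1. $Y_G$ is 2-Schur-positive, that is, $[s_\lambda]Y_G\ge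 0$ for all partitions $\lambda$ with at most two parts (the empty partition included). 2. $[s_{(k,k)}]Y_G\ge 0$ for all $k\ge 1$. 3. $I_G(t)$ is log-concave, that is, $i_j^2\ge i_{j-1}i_{j+1}$ for all $1\le j\le d-1$. 4. $I_G(t)$ is strongly log-concave, that is, $i_m i_n\ge i_p i_q$ for all integers $0\le p<m\le n<q\le d$ with $m+n=p+q$. -/

import Mathlib

noncomputable section

open Finset

/-! ## Log-concavity of polynomials -/

/-- `a_0 + a_1 t + ⋯ + a_d t^d` is log-concave: `a_j ^ 2 ≥ a_{j-1} a_{j+1}` for `1 ≤ j ≤ d - 1`,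
where `d` is the degree. -/
def Polynomial.IsLogConcave (P : Polynomial ℚ) : Prop :=
  ∀ j : ℕ, 1 ≤ j → j + 1 ≤ P.natDegree →
    P.coeff (j - 1) * P.coeff (j + 1) ≤ P.coeff j ^ 2

/-- `a_0 + a_1 t + ⋯ + a_d t^d` is strongly log-concave: `a_m a_n ≥ a_p a_q` for all
`0 ≤ p < m ≤ n < q ≤ d` with `m + n = p + q`. -/
def Polynomial.IsStronglyLogConcave (P : Polynomial ℚ) : Prop :=
  ∀ p m n q : ℕ, p < m → m ≤ n → n < q → q ≤ P.natDegree → m + n = p + q →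
    P.coeff p * P.coeff q ≤ P.coeff m * P.coeff n

/-! ## Symmetric functions in the variables `x_0, x_1, x_2, …` -/

open Classical in
/-- The elementary symmetric function `e_k`, the sum of all squarefree monomials of degree `k`.
The index is an integer; `e_0 = 1`, and `e_k = 0` for `k < 0`. -/
def elemSymm (k : ℤ) : MvPowerSeries ℕ ℚ := fun d =>
  if (∀ i, d i ≤ 1) ∧ (d.degree : ℤ) = k then 1 else 0

/-- The Schur function `s_μ`, by the dual Jacobi–Trudi identity
`s_μ = det (e_{μ'_i - i + j})`, where the `μ'_i` are the parts of the conjugate partition, that is,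
the column lengths of the Young diagram `μ`. Partitions are represented by Young diagrams. -/
def schur (μ : YoungDiagram) : MvPowerSeries ℕ ℚ :=
  Matrix.det (Matrix.of fun i j : Fin (μ.rowLen 0) =>
    elemSymm ((μ.colLen i : ℤ) - (i : ℤ) + (j : ℤ)))

theorem finite_youngDiagram_card (n : ℕ) : {μ : YoungDiagram | μ.card = n}.Finite := by
  have hinj : Function.Injective YoungDiagram.cells := fun a b h => YoungDiagram.ext h
  refine Set.Finite.of_finite_image
    (Set.Finite.subset (Finset.finite_toSet (Finset.range n ×ˢ Finset.range n).powerset) ?_)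
    hinj.injOn
  rintro _ ⟨μ, hμ, rfl⟩
  simp only [Set.mem_ofPred_eq] at hμ
  simp only [coe_powerset, Set.mem_preimage, Set.mem_powerset_iff, coe_subset]
  rintro ⟨i, j⟩ hc
  rw [YoungDiagram.mem_cells] at hc
  have h1 : μ.rowLen i ≤ n := by
    rw [YoungDiagram.rowLen_eq_card, ← hμ]
    exact Finset.card_le_card (Finset.filter_subset _ _)
  have h2 : μ.colLen j ≤ n := by
    rw [YoungDiagram.colLen_eq_card, ← hμ]
    exact Finset.card_le_card (Finset.filter_subset _ _)
  have h3 := YoungDiagram.mem_iff_lt_rowLen.1 hc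
  have h4 := YoungDiagram.mem_iff_lt_colLen.1 hc
  simp only [mem_product, mem_range]
  omega

/-- `f = ∑_μ c_μ s_μ`, for `f` of possibly unbounded degree: since `s_μ` is homogeneous of degree
`|μ|`, this says that for every `n` the degree-`n` component of `f` is the (finite) sum of
`c_μ s_μ` over the partitions `μ` of `n`. -/
def HasSchurExpansion (f : MvPowerSeries ℕ ℚ) (c : YoungDiagram → ℚ) : Prop :=
  ∀ n : ℕ, MvPowerSeries.homogeneousComponent n f =
    ∑ μ ∈ (finite_youngDiagram_card n).toFinset, c μ • schur μ

open Classical in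
/-- `[s_μ] f`, the coefficient of `s_μ` in the Schur expansion of `f`
(and `0` if `f` has no Schur expansion). -/
def schurCoeff (f : MvPowerSeries ℕ ℚ) (μ : YoungDiagram) : ℚ :=
  if h : ∃ c, HasSchurExpansion f c then h.choose μ else 0

/-- `f` is 2-Schur-positive: `[s_μ] f ≥ 0` for all `μ` of length (number of rows) at most 2. -/
def TwoSchurPositive (f : MvPowerSeries ℕ ℚ) : Prop :=
  ∀ μ : YoungDiagram, μ.colLen 0 ≤ 2 → 0 ≤ schurCoeff f μ

/-- The partition `(k, k)`. -/
def twoRowSquare (k : ℕ) : YoungDiagram :=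
  YoungDiagram.ofRowLens [k, k] (List.Pairwise.sortedGE (by simp))

/-! ## Graphs -/

namespace SimpleGraph

variable {V : Type*} [Fintype V] (G : SimpleGraph V)

/-- The independence polynomial `I_G(t) = ∑_j i_j t^j`, where `i_j` is the number of independent
sets of `G` with `j` elements, and `j` runs up to the independence number of `G`. -/
def indepPoly : Polynomial ℚ :=
  ∑ j ∈ Finset.range (G.indepNum + 1),
    Polynomial.monomial j (Nat.card {s : Finset V // G.IsNIndepSet j s} : ℚ)

/-- The proper multicolorings of `G` of type `α`: maps `κ` that assign to each vertex `v` a set of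
`α v` colors such that the sets of adjacent vertices are disjoint. Colors are natural numbers,
color `i` corresponding to the variable `x_i`. -/
def ProperMulticoloring (α : V → ℕ) : Type _ :=
  {κ : V → Finset ℕ // (∀ v, (κ v).card = α v) ∧ ∀ u v, G.Adj u v → Disjoint (κ u) (κ v)}

variable {G} in
/-- The exponent `(a_0, a_1, …)` of the monomial of a multicoloring:
`a_i` is the number of vertices `v` with `i ∈ κ v`. -/
def ProperMulticoloring.content {α : V → ℕ} (κ : G.ProperMulticoloring α) : ℕ →₀ ℕ :=
  ∑ v, ∑ i ∈ κ.1 v, Finsupp.single i 1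

variable {G} in
theorem ProperMulticoloring.content_apply {α : V → ℕ} (κ : G.ProperMulticoloring α) (i : ℕ) :
    κ.content i = #{v | i ∈ κ.1 v} := by
  rw [Finset.card_filter]
  simp [content, Finsupp.finsetSum_apply, Finsupp.single_apply, Finset.sum_ite_eq', -sum_boole]

/-- Only finitely many multicolorings contribute to a given monomial. -/
theorem finite_properMulticoloring_content (α : V → ℕ) (d : ℕ →₀ ℕ) :
    Finite {κ : G.ProperMulticoloring α // κ.content = d} := by
  classical
  let F : {κ : G.ProperMulticoloring α // κ.content = d} → (V → d.support.powerset) := fun κ v =>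
    ⟨κ.1.1 v, by
      rw [Finset.mem_powerset]
      intro i hi
      rw [Finsupp.mem_support_iff, ← κ.2, ProperMulticoloring.content_apply]
      exact Finset.card_ne_zero_of_mem (a := v) (by simpa using hi)⟩
  refine Finite.of_injective F fun κ κ' h => ?_
  apply Subtype.ext
  apply Subtype.ext
  funext v
  exact congrArg Subtype.val (congrFun h v)

/-- Stanley's multicoloring chromatic symmetric function
`X_G^α = ∑_κ x_0^{a_0} x_1^{a_1} ⋯`, over the proper multicolorings `κ` of type `α`: the coefficient
of a monomial is the number of such `κ` with that monomial. -/
def chromX (α : V → ℕ) : MvPowerSeries ℕ ℚ := fun d =>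
  (Nat.card {κ : G.ProperMulticoloring α // κ.content = d} : ℚ)

/-- `Y_G = ∑_α X_G^α` over all `α : V → ℕ`, taken coefficientwise (the sums are finite). -/
def chromY : MvPowerSeries ℕ ℚ := fun d =>
  ∑ᶠ α : V → ℕ, MvPowerSeries.coeff d (G.chromX α)

/-- The sums that define the coefficients of `Y_G` are finite. -/
theorem finite_support_chromX (d : ℕ →₀ ℕ) :
    (Function.support fun α : V → ℕ => MvPowerSeries.coeff d (G.chromX α)).Finite := by
  classical
  refine (Set.finite_Iic (fun _ : V => d.degree)).subset fun α hα v => ?_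
  have h : Nat.card {κ : G.ProperMulticoloring α // κ.content = d} ≠ 0 := by
    intro h0
    apply hα
    change ((Nat.card {κ : G.ProperMulticoloring α // κ.content = d} : ℕ) : ℚ) = 0
    rw [h0, Nat.cast_zero]
  obtain ⟨⟨κ, hκ⟩⟩ := (Nat.card_ne_zero.1 h).1
  rw [← hκ, ProperMulticoloring.content]
  simp only [map_sum, Finsupp.degree_single, Finset.sum_const, smul_eq_mul, mul_one]
  rw [← κ.2.1 v]
  exact Finset.single_le_sum (f := fun v => (κ.1 v).card) (fun _ _ => Nat.zero_le _)
    (Finset.mem_univ v)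

end SimpleGraph

end

noncomputable section

open Finset

/-! ## Expansion of a power series in its first variable -/

/-- The exponent `(m, d 0, d 1, …)`. -/
def Finsupp.natCons (m : ℕ) (d : ℕ →₀ ℕ) : ℕ →₀ ℕ :=
  Finsupp.single 0 m + d.mapDomain Nat.succ

theorem Finsupp.natCons_zero (m : ℕ) (d : ℕ →₀ ℕ) : Finsupp.natCons m d 0 = m := by
  simp [natCons, Finsupp.mapDomain_of_notMem_range]

theorem Finsupp.natCons_succ (m : ℕ) (d : ℕ →₀ ℕ) (i : ℕ) :
    Finsupp.natCons m d (i + 1) = d i := by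
  simpa [natCons] using Finsupp.mapDomain_apply Nat.succ_injective d i

theorem Finsupp.natCons_eq_iff {m : ℕ} {d e : ℕ →₀ ℕ} :
    Finsupp.natCons m d = e ↔ m = e 0 ∧ ∀ i, d i = e (i + 1) := by
  constructor
  · rintro rfl
    simp [natCons_zero, natCons_succ]
  · rintro ⟨h0, h⟩
    ext i
    cases i with
    | zero => rw [natCons_zero, h0]
    | succ i => rw [natCons_succ, h]

/-- The exponent `(d 1, d 2, …)`. -/
def Finsupp.natTail (d : ℕ →₀ ℕ) : ℕ →₀ ℕ := d.comapDomain Nat.succ Nat.succ_injective.injOn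

theorem Finsupp.natTail_apply (d : ℕ →₀ ℕ) (i : ℕ) : d.natTail i = d (i + 1) := rfl

theorem Finsupp.natCons_add (m n : ℕ) (d e : ℕ →₀ ℕ) :
    Finsupp.natCons m d + Finsupp.natCons n e = Finsupp.natCons (m + n) (d + e) := by
  symm
  rw [natCons_eq_iff]
  simp [natCons_zero, natCons_succ]

theorem Finsupp.degree_natCons (m : ℕ) (d : ℕ →₀ ℕ) :
    (Finsupp.natCons m d).degree = m + d.degree := by
  simp [natCons, Finsupp.degree_mapDomain]

namespace MvPowerSeries

variable {R : Type*} [CommRing R]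

/-- The coefficient of `x_0 ^ m` in a power series in `x_0, x_1, …`, the remaining variables being
renamed to `x_0, x_1, …`. -/
def coeffFirst (m : ℕ) (f : MvPowerSeries ℕ R) : MvPowerSeries ℕ R :=
  fun d => coeff (Finsupp.natCons m d) f

theorem coeff_coeffFirst (m : ℕ) (f : MvPowerSeries ℕ R) (d : ℕ →₀ ℕ) :
    coeff d (coeffFirst m f) = coeff (Finsupp.natCons m d) f := rfl

theorem coeff_eq_coeff_coeffFirst (f : MvPowerSeries ℕ R) (d : ℕ →₀ ℕ) :
    coeff d f = coeff d.natTail (coeffFirst (d 0) f) := by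
  rw [coeff_coeffFirst, Finsupp.natCons_eq_iff.2 ⟨rfl, fun _ => rfl⟩]

/-- The expansion of a power series in `x_0, x_1, …` as a power series in `x_0`, the remaining
variables being renamed to `x_0, x_1, …`. -/
def expandFirst : MvPowerSeries ℕ R →+* PowerSeries (MvPowerSeries ℕ R) where
  toFun f := PowerSeries.mk fun m => coeffFirst m f
  map_zero' := by
    ext m d
    rw [PowerSeries.coeff_mk, coeff_coeffFirst]
    rfl
  map_one' := by
    classical
    ext m d
    rw [PowerSeries.coeff_mk, PowerSeries.coeff_one, coeff_coeffFirst]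
    have h : Finsupp.natCons m d = 0 ↔ m = 0 ∧ d = 0 := by
      rw [Finsupp.natCons_eq_iff, Finsupp.ext_iff]
      rfl
    rw [coeff_one]
    by_cases hm : m = 0
    · subst hm
      simp [h, coeff_one]
    · simp [h, hm]
  map_add' f g := by
    ext m d
    simp only [PowerSeries.coeff_mk, map_add, coeff_coeffFirst]
  map_mul' f g := by
    classical
    ext m d
    rw [PowerSeries.coeff_mk, PowerSeries.coeff_mul, coeff_coeffFirst, coeff_mul, map_sum]
    simp_rw [PowerSeries.coeff_mk, coeff_mul]
    rw [Finset.sum_sigma']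
    refine Finset.sum_bij'
      (fun p _ => ⟨(p.1 0, p.2 0), (p.1.natTail, p.2.natTail)⟩)
      (fun q _ => (Finsupp.natCons q.1.1 q.2.1, Finsupp.natCons q.1.2 q.2.2)) ?_ ?_ ?_ ?_ ?_
    · rintro ⟨a, b⟩ h
      simp only [HasAntidiagonal.mem_antidiagonal] at h
      rw [eq_comm, Finsupp.natCons_eq_iff] at h
      simp only [mem_sigma, HasAntidiagonal.mem_antidiagonal]
      refine ⟨h.1.symm, ?_⟩
      ext i
      exact (h.2 i).symm
    · rintro ⟨⟨a, b⟩, c, d'⟩ h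
      simp only [mem_sigma, HasAntidiagonal.mem_antidiagonal] at h
      simp only [HasAntidiagonal.mem_antidiagonal, Finsupp.natCons_add, h.1, h.2]
    · rintro ⟨a, b⟩ h
      refine Prod.ext ?_ ?_ <;> exact Finsupp.natCons_eq_iff.2 ⟨rfl, fun i => rfl⟩
    · rintro ⟨⟨a, b⟩, c, d'⟩ h
      have hc (m : ℕ) (e : ℕ →₀ ℕ) : (Finsupp.natCons m e).natTail = e := by
        ext i
        rw [Finsupp.natTail_apply, Finsupp.natCons_succ]
      simp only [Finsupp.natCons_zero, hc]
    · rintro ⟨a, b⟩ h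
      exact congrArg₂ _ (coeff_eq_coeff_coeffFirst f a) (coeff_eq_coeff_coeffFirst g b)

theorem coeff_coeff_expandFirst (f : MvPowerSeries ℕ R) (m : ℕ) (d : ℕ →₀ ℕ) :
    coeff d (PowerSeries.coeff m (expandFirst f)) = coeff (Finsupp.natCons m d) f := by
  rw [← coeff_coeffFirst]
  exact congrArg _ (PowerSeries.coeff_mk m fun m => coeffFirst m f)

end MvPowerSeries

open MvPowerSeries

/-! ## Elementary symmetric functions and their Jacobi–Trudi determinants -/

open Classical in
theorem coeff_elemSymm (k : ℤ) (d : ℕ →₀ ℕ) :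
    coeff d (elemSymm k) = if (∀ i, d i ≤ 1) ∧ (d.degree : ℤ) = k then 1 else 0 := rfl

theorem elemSymm_zero : elemSymm 0 = 1 := by
  classical
  ext d
  rw [coeff_elemSymm, coeff_one]
  refine if_congr ⟨fun h => ?_, ?_⟩ rfl rfl
  · exact (Finsupp.degree_eq_zero_iff d).1 (by exact_mod_cast h.2)
  · rintro rfl
    simp

theorem elemSymm_of_neg {k : ℤ} (hk : k < 0) : elemSymm k = 0 := by
  classical
  ext d
  rw [coeff_elemSymm, if_neg]
  · rfl
  · rintro ⟨-, h⟩
    omega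

theorem expandFirst_elemSymm (k : ℤ) :
    expandFirst (elemSymm k) =
      PowerSeries.C (elemSymm k) + PowerSeries.X * PowerSeries.C (elemSymm (k - 1)) := by
  classical
  ext m d
  rw [coeff_coeff_expandFirst, coeff_elemSymm, Finsupp.degree_natCons, map_add, map_add]
  have h1 : (∀ i, Finsupp.natCons m d i ≤ 1) ↔ m ≤ 1 ∧ ∀ i, d i ≤ 1 := by
    refine ⟨fun h => ⟨by simpa [Finsupp.natCons_zero] using h 0, fun i => by
      simpa [Finsupp.natCons_succ] using h (i + 1)⟩, fun h i => ?_⟩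
    cases i with
    | zero => rw [Finsupp.natCons_zero]; exact h.1
    | succ i => rw [Finsupp.natCons_succ]; exact h.2 i
  rw [h1]
  match m with
  | 0 =>
    rw [PowerSeries.coeff_zero_X_mul, PowerSeries.coeff_C, if_pos rfl, map_zero, add_zero,
      coeff_elemSymm]
    congr 1
    simp
  | 1 =>
    rw [PowerSeries.coeff_C, if_neg one_ne_zero, PowerSeries.coeff_succ_X_mul 0,
      PowerSeries.coeff_C, if_pos rfl, coeff_elemSymm, map_zero, zero_add]
    congr 1
    refine propext ⟨fun h => ⟨h.1.2, ?_⟩, fun h => ⟨⟨le_rfl, h.1⟩, ?_⟩⟩ <;>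
      (have := h.2; push_cast at *; omega)
  | m + 2 =>
    rw [PowerSeries.coeff_C, if_neg (by omega), PowerSeries.coeff_succ_X_mul,
      PowerSeries.coeff_C, if_neg (by omega), if_neg (by omega)]
    simp

/-- The determinant `det (e_{c_i - i + j})` of size `r`. -/
def elemSymmDet (r : ℕ) (c : ℕ → ℤ) : MvPowerSeries ℕ ℚ :=
  Matrix.det (Matrix.of fun i j : Fin r => elemSymm (c i - (i : ℤ) + (j : ℤ)))

theorem schur_eq_elemSymmDet (μ : YoungDiagram) :
    schur μ = elemSymmDet (μ.rowLen 0) fun i => (μ.colLen i : ℤ) := rfl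

theorem elemSymmDet_congr {r : ℕ} {c c' : ℕ → ℤ} (h : ∀ i < r, c i = c' i) :
    elemSymmDet r c = elemSymmDet r c' := by
  unfold elemSymmDet
  congr 1
  ext1 i j
  simp only [Matrix.of_apply, h i i.2]

theorem elemSymmDet_succ {r : ℕ} {c : ℕ → ℤ} (h : c r = 0) :
    elemSymmDet (r + 1) c = elemSymmDet r c := by
  unfold elemSymmDet
  rw [Matrix.det_succ_row _ (Fin.last r), Finset.sum_eq_single (Fin.last r)]
  · simp only [Fin.val_last, Matrix.of_apply, h, zero_sub, neg_add_cancel, elemSymm_zero]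
    rw [Even.neg_one_pow (Even.add_self r), one_mul, one_mul]
    congr 1
    ext1 i j
    simp
  · intro j _ hj
    have : (j : ℕ) < r := Fin.val_lt_last hj
    rw [Matrix.of_apply, elemSymm_of_neg, mul_zero, zero_mul]
    rw [Fin.val_last, h]
    omega
  · simp

theorem elemSymmDet_of_le {r s : ℕ} (hrs : r ≤ s) {c : ℕ → ℤ} (h : ∀ i, r ≤ i → i < s → c i = 0) :
    elemSymmDet s c = elemSymmDet r c := by
  induction s, hrs using Nat.le_induction with
  | base => rfl
  | succ s hs ih =>
    rw [elemSymmDet_succ (h s hs (Nat.lt_succ_self s))]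
    exact ih fun i hi hi' => h i hi (by omega)

theorem expandFirst_elemSymmDet (r : ℕ) (c : ℕ → ℤ) :
    expandFirst (elemSymmDet r c) = ((Matrix.det ((Polynomial.X : Polynomial (MvPowerSeries ℕ ℚ)) •
      (Matrix.of fun i j : Fin r => elemSymm (c i - 1 - (i : ℤ) + (j : ℤ))).map Polynomial.C +
      (Matrix.of fun i j : Fin r => elemSymm (c i - (i : ℤ) + (j : ℤ))).map Polynomial.C) :
        Polynomial (MvPowerSeries ℕ ℚ)) : PowerSeries (MvPowerSeries ℕ ℚ)) := by
  unfold elemSymmDet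
  rw [RingHom.map_det, ← Polynomial.coeToPowerSeries.ringHom_apply, RingHom.map_det]
  congr 1
  ext1 i j
  simp only [RingHom.mapMatrix_apply, Matrix.map_apply, Matrix.of_apply, expandFirst_elemSymm,
    Matrix.add_apply, Matrix.smul_apply, smul_eq_mul, map_add, map_mul,
    Polynomial.coeToPowerSeries.ringHom_apply, Polynomial.coe_C, Polynomial.coe_X]
  rw [add_comm, show c i - (i : ℤ) + j - 1 = c i - 1 - i + j by ring]

theorem coeff_natCons_elemSymmDet_of_lt {r m : ℕ} (h : r < m) (c : ℕ → ℤ) (d : ℕ →₀ ℕ) :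
    coeff (Finsupp.natCons m d) (elemSymmDet r c) = 0 := by
  rw [← coeff_coeff_expandFirst, expandFirst_elemSymmDet, Polynomial.coeff_coe,
    Polynomial.coeff_eq_zero_of_natDegree_lt, map_zero]
  exact (Polynomial.natDegree_det_X_add_C_le _ _).trans_lt (by simpa using h)

theorem coeff_natCons_elemSymmDet_self (r : ℕ) (c : ℕ → ℤ) (d : ℕ →₀ ℕ) :
    coeff (Finsupp.natCons r d) (elemSymmDet r c) = coeff d (elemSymmDet r fun i => c i - 1) := by
  rw [← coeff_coeff_expandFirst, expandFirst_elemSymmDet, Polynomial.coeff_coe]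
  congr 1
  have := Polynomial.coeff_det_X_add_C_card
    (Matrix.of fun i j : Fin r => elemSymm (c i - 1 - (i : ℤ) + (j : ℤ)))
    (Matrix.of fun i j : Fin r => elemSymm (c i - (i : ℤ) + (j : ℤ)))
  rwa [Fintype.card_fin] at this

/-! ## Triangularity of the Schur functions -/

namespace YoungDiagram

theorem rowLen_eq_zero_of_card_le (μ : YoungDiagram) {i : ℕ} (hi : μ.card ≤ i) :
    μ.rowLen i = 0 := by
  by_contra h
  have h0 : (i, 0) ∈ μ := mem_iff_lt_rowLen.2 (Nat.pos_of_ne_zero h)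
  have h1 : i < μ.colLen 0 := mem_iff_lt_colLen.1 h0
  have h2 : μ.colLen 0 ≤ μ.card := by
    rw [colLen_eq_card]
    exact Finset.card_le_card (Finset.filter_subset _ _)
  omega

/-- The exponent `(λ_0, λ_1, …)` of a partition. -/
def exponent (μ : YoungDiagram) : ℕ →₀ ℕ :=
  Finsupp.onFinset (range μ.card) μ.rowLen fun i hi => by
    rw [mem_range]
    by_contra h
    exact hi (μ.rowLen_eq_zero_of_card_le (not_lt.1 h))

theorem exponent_apply (μ : YoungDiagram) (i : ℕ) : μ.exponent i = μ.rowLen i := rfl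

theorem rowLen_injective : Function.Injective rowLen := by
  intro μ ν h
  ext ⟨i, j⟩
  rw [mem_cells, mem_cells, mem_iff_lt_rowLen, mem_iff_lt_rowLen, h]

theorem sum_rowLen {μ : YoungDiagram} {n : ℕ} (h : ∀ i, n ≤ i → μ.rowLen i = 0) :
    ∑ i ∈ range n, μ.rowLen i = μ.card := by
  have hm : ∀ c ∈ μ.cells, c.1 ∈ range n := by
    rintro ⟨i, j⟩ hc
    rw [mem_range]
    by_contra hi
    have := mem_iff_lt_rowLen.1 ((mem_cells _).1 hc)
    rw [h i (not_lt.1 hi)] at this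
    omega
  rw [YoungDiagram.card, Finset.card_eq_sum_card_fiberwise hm]
  refine Finset.sum_congr rfl fun i _ => ?_
  rw [rowLen_eq_card]
  rfl

theorem degree_exponent (μ : YoungDiagram) : μ.exponent.degree = μ.card := by
  rw [← sum_rowLen fun i => μ.rowLen_eq_zero_of_card_le, Finsupp.degree_apply]
  exact Finset.sum_subset Finsupp.support_onFinset_subset fun i _ hi => by
    simpa using! hi

/-- The exponent `(λ_k, λ_{k + 1}, …)` of a partition. -/
def exponentFrom (μ : YoungDiagram) : ℕ → ℕ →₀ ℕ
  | 0 => μ.exponent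
  | k + 1 => (μ.exponentFrom k).natTail

theorem exponentFrom_apply (μ : YoungDiagram) (k i : ℕ) :
    μ.exponentFrom k i = μ.rowLen (k + i) := by
  induction k generalizing i with
  | zero => rw [Nat.zero_add]; rfl
  | succ k ih =>
    rw [exponentFrom, Finsupp.natTail_apply, ih]
    congr 1
    omega

theorem exponentFrom_eq_natCons (μ : YoungDiagram) (k : ℕ) :
    μ.exponentFrom k = Finsupp.natCons (μ.rowLen k) (μ.exponentFrom (k + 1)) := by
  symm
  rw [Finsupp.natCons_eq_iff, exponentFrom_apply]
  exact ⟨rfl, fun i => rfl⟩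

/-- The dual Jacobi–Trudi determinant of `μ` without its first `k` rows. -/
def schurFrom (μ : YoungDiagram) (k : ℕ) : MvPowerSeries ℕ ℚ :=
  elemSymmDet (μ.rowLen k) fun i => (μ.colLen i : ℤ) - k

theorem schurFrom_zero (μ : YoungDiagram) : μ.schurFrom 0 = schur μ := by
  simp [schurFrom, schur_eq_elemSymmDet]

theorem coeff_schurFrom_of_lt {lam μ : YoungDiagram} {k : ℕ} (h : μ.rowLen k < lam.rowLen k) :
    coeff (lam.exponentFrom k) (μ.schurFrom k) = 0 := by
  rw [exponentFrom_eq_natCons]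
  exact coeff_natCons_elemSymmDet_of_lt h _ _

theorem coeff_schurFrom_succ {lam μ : YoungDiagram} {k : ℕ} (h : lam.rowLen k = μ.rowLen k) :
    coeff (lam.exponentFrom k) (μ.schurFrom k) =
      coeff (lam.exponentFrom (k + 1)) (μ.schurFrom (k + 1)) := by
  rw [exponentFrom_eq_natCons, h, schurFrom, coeff_natCons_elemSymmDet_self, schurFrom,
    elemSymmDet_of_le (μ.rowLen_anti k (k + 1) (Nat.le_succ k))]
  · congr 1
    refine elemSymmDet_congr fun i _ => ?_
    push_cast
    ring
  · intro i hi hi'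
    have h1 : k < μ.colLen i := mem_iff_lt_colLen.1 (mem_iff_lt_rowLen.2 hi')
    have h2 : ¬ k + 1 < μ.colLen i := fun h' =>
      absurd (mem_iff_lt_rowLen.1 (mem_iff_lt_colLen.2 h')) (not_lt.2 hi)
    omega

theorem coeff_schur_eq_coeff_schurFrom {lam μ : YoungDiagram} {k : ℕ}
    (h : ∀ i < k, lam.rowLen i = μ.rowLen i) :
    coeff lam.exponent (schur μ) = coeff (lam.exponentFrom k) (μ.schurFrom k) := by
  induction k with
  | zero => rw [schurFrom_zero]; rfl
  | succ k ih =>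
    rw [ih fun i hi => h i (by omega), coeff_schurFrom_succ (h k (Nat.lt_succ_self k))]

theorem coeff_exponent_schur_self (μ : YoungDiagram) : coeff μ.exponent (schur μ) = 1 := by
  have h := coeff_schur_eq_coeff_schurFrom (lam := μ) (μ := μ) (k := μ.card) fun _ _ => rfl
  have h0 : μ.exponentFrom μ.card = 0 := by
    ext i
    rw [exponentFrom_apply, rowLen_eq_zero_of_card_le _ (by omega)]
    rfl
  have h1 : μ.schurFrom μ.card = 1 := by
    rw [schurFrom, rowLen_eq_zero_of_card_le _ le_rfl]
    exact Matrix.det_fin_zero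
  rw [h, h0, h1]
  exact coeff_zero_one

theorem coeff_exponent_schur_of_lt {lam μ : YoungDiagram}
    (h : toLex μ.rowLen < toLex lam.rowLen) : coeff lam.exponent (schur μ) = 0 := by
  obtain ⟨k, hk, hlt⟩ := h
  rw [coeff_schur_eq_coeff_schurFrom fun i hi => (hk i hi).symm]
  exact coeff_schurFrom_of_lt hlt

end YoungDiagram

/-! ## Homogeneity and symmetry of the Schur functions -/

theorem degree_eq_of_coeff_prod_ne_zero {ι : Type*} (s : Finset ι)
    (f : ι → MvPowerSeries ℕ ℚ) (k : ι → ℤ)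
    (hf : ∀ i ∈ s, ∀ d, coeff d (f i) ≠ 0 → (d.degree : ℤ) = k i) {d : ℕ →₀ ℕ}
    (hd : coeff d (∏ i ∈ s, f i) ≠ 0) : (d.degree : ℤ) = ∑ i ∈ s, k i := by
  classical
  rw [coeff_prod] at hd
  obtain ⟨l, hl, hne⟩ := Finset.exists_ne_zero_of_sum_ne_zero hd
  rw [mem_finsuppAntidiag] at hl
  rw [← hl.1, map_sum, Nat.cast_sum]
  exact Finset.sum_congr rfl fun i hi => hf i hi _ (Finset.prod_ne_zero_iff.1 hne i hi)

theorem degree_eq_of_coeff_elemSymm_ne_zero {k : ℤ} {d : ℕ →₀ ℕ}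
    (h : coeff d (elemSymm k) ≠ 0) : (d.degree : ℤ) = k := by
  classical
  rw [coeff_elemSymm] at h
  by_contra hd
  exact h (if_neg fun h' => hd h'.2)

theorem degree_eq_of_coeff_elemSymmDet_ne_zero {r : ℕ} {c : ℕ → ℤ} {d : ℕ →₀ ℕ}
    (h : coeff d (elemSymmDet r c) ≠ 0) : (d.degree : ℤ) = ∑ i ∈ range r, c i := by
  rw [elemSymmDet, ← Matrix.det_transpose, Matrix.det_apply, map_sum] at h
  obtain ⟨σ, -, hσ⟩ := Finset.exists_ne_zero_of_sum_ne_zero h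
  have hne : coeff d (∏ i : Fin r, elemSymm (c i - (i : ℤ) + (σ i : ℤ))) ≠ 0 := by
    intro h0
    apply hσ
    rw [Units.smul_def, map_zsmul]
    exact (congrArg _ h0).trans (smul_zero _)
  rw [degree_eq_of_coeff_prod_ne_zero univ _ _
    (fun i _ d => degree_eq_of_coeff_elemSymm_ne_zero) hne, Finset.sum_add_distrib,
    Finset.sum_sub_distrib, Equiv.sum_comp σ fun i : Fin r => (i : ℤ), sub_add_cancel,
    Finset.sum_range]

namespace YoungDiagram

theorem card_transpose (μ : YoungDiagram) : μ.transpose.card = μ.card := by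
  change (Finset.map _ _).card = _
  exact Finset.card_map _

theorem sum_colLen (μ : YoungDiagram) : ∑ i ∈ range (μ.rowLen 0), μ.colLen i = μ.card := by
  simp_rw [← rowLen_transpose]
  rw [sum_rowLen, card_transpose]
  intro i hi
  rw [rowLen_transpose]
  by_contra h
  exact absurd (mem_iff_lt_rowLen.1 (mem_iff_lt_colLen.2 (Nat.pos_of_ne_zero h))) (not_lt.2 hi)

end YoungDiagram

theorem coeff_schur_of_degree_ne {μ : YoungDiagram} {d : ℕ →₀ ℕ} (h : d.degree ≠ μ.card) :
    coeff d (schur μ) = 0 := by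
  by_contra hne
  apply h
  rw [schur_eq_elemSymmDet] at hne
  have := degree_eq_of_coeff_elemSymmDet_ne_zero hne
  rw [← Nat.cast_sum, YoungDiagram.sum_colLen] at this
  exact_mod_cast this

/-- A power series in `x_0, x_1, …` is symmetric if it is invariant under all permutations of the
variables. -/
def MvPowerSeries.IsSymm (f : MvPowerSeries ℕ ℚ) : Prop :=
  ∀ (e : Equiv.Perm ℕ) (d : ℕ →₀ ℕ), coeff (d.embDomain e.toEmbedding) f = coeff d f

theorem Finsupp.exists_eq_embDomain_perm (e : Equiv.Perm ℕ) (d : ℕ →₀ ℕ) :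
    ∃ d' : ℕ →₀ ℕ, d = d'.embDomain e.toEmbedding := by
  refine ⟨d.embDomain e.symm.toEmbedding, ?_⟩
  ext i
  obtain ⟨j, rfl⟩ := e.surjective i
  rw [← Equiv.coe_toEmbedding e, Finsupp.embDomain_apply_self]
  obtain ⟨i, rfl⟩ := e.symm.surjective j
  rw [← Equiv.coe_toEmbedding e.symm, Finsupp.embDomain_apply_self]
  simp

theorem Finsupp.forall_embDomain_le_one_iff (e : Equiv.Perm ℕ) (d : ℕ →₀ ℕ) :
    (∀ i, d.embDomain e.toEmbedding i ≤ 1) ↔ ∀ i, d i ≤ 1 := by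
  rw [← e.forall_congr_right]
  refine forall_congr' fun i => ?_
  rw [← Equiv.coe_toEmbedding e, Finsupp.embDomain_apply_self]

theorem rename_elemSymm (e : Equiv.Perm ℕ) (k : ℤ) :
    rename e.toEmbedding (elemSymm k) = elemSymm k := by
  classical
  ext d
  obtain ⟨d, rfl⟩ := Finsupp.exists_eq_embDomain_perm e d
  rw [coeff_embDomain_rename, coeff_elemSymm, coeff_elemSymm]
  rw [Finsupp.embDomain_eq_mapDomain, Finsupp.degree_mapDomain, ← Finsupp.embDomain_eq_mapDomain]
  simp only [Finsupp.forall_embDomain_le_one_iff]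

theorem isSymm_schur (μ : YoungDiagram) : (schur μ).IsSymm := by
  intro e d
  have h : rename e.toEmbedding (schur μ) = schur μ := by
    rw [schur, AlgHom.map_det]
    congr 1
    ext1 i j
    exact rename_elemSymm e _
  conv_lhs => rw [← h]
  exact coeff_embDomain_rename _ _ _

/-! ## Existence and uniqueness of Schur expansions -/

/-- The Young diagram with given row lengths. -/
def YoungDiagram.ofAntitone (d : ℕ →₀ ℕ) (hd : Antitone d) : YoungDiagram where
  cells := {c ∈ d.support ×ˢ range (d 0) | c.2 < d c.1}
  isLowerSet := by
    rintro ⟨i, j⟩ ⟨i', j'⟩ ⟨hi, hj⟩ h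
    simp only [coe_filter, mem_product, mem_range, Finsupp.mem_support_iff, ne_eq,
      Set.mem_ofPred_eq] at h ⊢
    simp only at hi hj
    have h1 := hd hi
    have h2 := hd (Nat.zero_le i')
    omega

theorem YoungDiagram.exponent_ofAntitone (d : ℕ →₀ ℕ) (hd : Antitone d) :
    (ofAntitone d hd).exponent = d := by
  ext i
  refine eq_of_forall_lt_iff fun j => ?_
  rw [exponent_apply, ← mem_iff_lt_rowLen, ← mem_cells]
  simp only [ofAntitone, mem_filter, mem_product, mem_range, Finsupp.mem_support_iff]
  have := hd (Nat.zero_le i)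
  omega

theorem exists_embDomain_perm_eq_exponent (d : ℕ →₀ ℕ) :
    ∃ (e : Equiv.Perm ℕ) (μ : YoungDiagram), d.embDomain e.toEmbedding = μ.exponent := by
  obtain ⟨N, hN⟩ : ∃ N, ∀ i, N ≤ i → d i = 0 := by
    refine ⟨d.support.sup id + 1, fun i hi => ?_⟩
    by_contra h
    have := Finset.le_sup (f := id) (Finsupp.mem_support_iff.2 h)
    simp only [id_eq] at this
    omega
  let g : Fin N → ℕᵒᵈ := fun i => OrderDual.toDual (d i)
  let σ := Tuple.sort g
  have hσ : Monotone (g ∘ σ) := Tuple.monotone_sort g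
  let e : Equiv.Perm ℕ := σ.extendDomain Fin.equivSubtype
  have he1 (i : Fin N) : e i = σ i := Equiv.Perm.extendDomain_apply_image σ Fin.equivSubtype i
  have he2 (i : ℕ) (hi : N ≤ i) : e i = i :=
    Equiv.Perm.extendDomain_apply_not_subtype σ Fin.equivSubtype (not_lt.2 hi)
  have happ (i : ℕ) : d.embDomain e.symm.toEmbedding i = d (e i) := by
    have := Finsupp.embDomain_apply_self e.symm.toEmbedding d (e i)
    rwa [Equiv.coe_toEmbedding, Equiv.symm_apply_apply] at this
  have hanti : Antitone (d.embDomain e.symm.toEmbedding) := by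
    intro i j hij
    rw [happ, happ]
    by_cases hj : j < N
    · have := hσ (show (⟨i, by omega⟩ : Fin N) ≤ ⟨j, hj⟩ from hij)
      rw [he1 ⟨i, by omega⟩, he1 ⟨j, hj⟩]
      exact this
    · rw [he2 j (not_lt.1 hj), hN j (not_lt.1 hj)]
      exact Nat.zero_le _
  exact ⟨e.symm, YoungDiagram.ofAntitone _ hanti, (YoungDiagram.exponent_ofAntitone _ hanti).symm⟩

theorem Matrix.existsUnique_mulVec_of_isUpperTriangular {ι : Type*} [Fintype ι] [LinearOrder ι]
    {M : Matrix ι ι ℚ} (hM : M.IsUpperTriangular) (h1 : ∀ i, M i i = 1) (v : ι → ℚ) :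
    ∃! c : ι → ℚ, M.mulVec c = v := by
  have hu : IsUnit M.det := by
    rw [det_of_isUpperTriangular hM]
    simp [h1]
  refine ⟨M⁻¹.mulVec v, ?_, fun c hc => ?_⟩
  · simp only [mulVec_mulVec, mul_nonsing_inv _ hu, one_mulVec]
  · rw [← hc, mulVec_mulVec, nonsing_inv_mul _ hu, one_mulVec]

theorem hasSchurExpansion_iff {f : MvPowerSeries ℕ ℚ} (hf : f.IsSymm) (c : YoungDiagram → ℚ) :
    HasSchurExpansion f c ↔ ∀ lam : YoungDiagram,
      ∑ μ ∈ (finite_youngDiagram_card lam.card).toFinset,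
        coeff lam.exponent (schur μ) * c μ = coeff lam.exponent f := by
  have hsum (n : ℕ) (d : ℕ →₀ ℕ) :
      coeff d (∑ μ ∈ (finite_youngDiagram_card n).toFinset, c μ • schur μ) =
        ∑ μ ∈ (finite_youngDiagram_card n).toFinset, coeff d (schur μ) * c μ := by
    rw [map_sum]
    refine Finset.sum_congr rfl fun μ _ => ?_
    rw [mul_comm]
    rfl
  constructor
  · intro h lam
    rw [← hsum, ← h, coeff_homogeneousComponent, if_pos lam.degree_exponent]
  · intro h n
    ext d
    rw [hsum, coeff_homogeneousComponent]
    split_ifs with hd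
    · obtain ⟨e, lam, he⟩ := exists_embDomain_perm_eq_exponent d
      have hcard : lam.card = n := by
        rw [← lam.degree_exponent, ← he, Finsupp.embDomain_eq_mapDomain,
          Finsupp.degree_mapDomain, hd]
      have := h lam
      rw [hcard, ← he, hf] at this
      simp_rw [isSymm_schur _ e] at this
      exact this.symm
    · symm
      refine Finset.sum_eq_zero fun μ hμ => ?_
      have hc : μ.card = n := by simpa using hμ
      rw [coeff_schur_of_degree_ne (by rwa [hc]), zero_mul]

theorem existsUnique_hasSchurExpansion {f : MvPowerSeries ℕ ℚ} (hf : f.IsSymm) :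
    ∃! c : YoungDiagram → ℚ, HasSchurExpansion f c := by
  simp_rw [hasSchurExpansion_iff hf]
  have key (n : ℕ) : ∃! c : (finite_youngDiagram_card n).toFinset → ℚ,
      ∀ lam : (finite_youngDiagram_card n).toFinset,
        ∑ μ, coeff lam.1.exponent (schur μ.1) * c μ = coeff lam.1.exponent f := by
    let : LinearOrder (finite_youngDiagram_card n).toFinset :=
      LinearOrder.lift' (fun μ => toLex μ.1.rowLen) fun μ ν h =>
        Subtype.ext (YoungDiagram.rowLen_injective h)
    have := Matrix.existsUnique_mulVec_of_isUpperTriangular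
      (M := Matrix.of fun lam μ : (finite_youngDiagram_card n).toFinset =>
        coeff lam.1.exponent (schur μ.1))
      (fun lam μ h => YoungDiagram.coeff_exponent_schur_of_lt h)
      (fun μ => YoungDiagram.coeff_exponent_schur_self μ.1)
      (fun lam => coeff lam.1.exponent f)
    simpa only [funext_iff] using! this
  have hmem (μ : YoungDiagram) : μ ∈ (finite_youngDiagram_card μ.card).toFinset := by simp
  choose c hc huniq using key
  have hcard {n : ℕ} (μ : (finite_youngDiagram_card n).toFinset) : μ.1.card = n :=
    (finite_youngDiagram_card n).mem_toFinset.1 μ.2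
  have hcast {n : ℕ} (μ : (finite_youngDiagram_card n).toFinset) :
      c μ.1.card ⟨μ.1, hmem μ.1⟩ = c n μ := by
    obtain ⟨μ, hμ⟩ := μ
    obtain rfl : μ.card = n := by simpa using hμ
    rfl
  refine ⟨fun μ => c μ.card ⟨μ, hmem μ⟩, fun lam => ?_, fun c' hc' => ?_⟩
  · rw [← hc lam.card ⟨lam, hmem lam⟩, ← Finset.sum_coe_sort]
    exact Finset.sum_congr rfl fun μ _ => congrArg _ (hcast μ)
  · funext μ
    have := huniq μ.card (fun ν => c' ν.1) fun lam => by
      have h := hc' lam.1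
      rw [hcard lam, ← Finset.sum_coe_sort] at h
      exact h
    exact congrFun this ⟨μ, hmem μ⟩

theorem hasSchurExpansion_schurCoeff {f : MvPowerSeries ℕ ℚ} (hf : f.IsSymm) :
    HasSchurExpansion f (schurCoeff f) := by
  have h := (existsUnique_hasSchurExpansion hf).exists
  have : schurCoeff f = h.choose := by
    funext μ
    exact dif_pos h
  rw [this]
  exact h.choose_spec

/-! ## Schur functions in two variables -/

section TwoVariables

variable {R : Type*} [CommRing R]

/-- The elementary symmetric polynomials in two variables. -/
def elemTwo (x y : R) (k : ℤ) : R :=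
  if k = 0 then 1 else if k = 1 then x + y else if k = 2 then x * y else 0

/-- The complete homogeneous symmetric polynomials in two variables. -/
def completeTwo (x y : R) : ℕ → R
  | 0 => 1
  | n + 1 => x * completeTwo x y n + y ^ (n + 1)

theorem completeTwo_add_two (x y : R) (n : ℕ) :
    completeTwo x y (n + 2) = (x + y) * completeTwo x y (n + 1) - x * y * completeTwo x y n := by
  rw [completeTwo, completeTwo]
  ring

theorem sub_mul_completeTwo (x y : R) (n : ℕ) :
    (x - y) * completeTwo x y n = x ^ (n + 1) - y ^ (n + 1) := by
  induction n with
  | zero => simp [completeTwo]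
  | succ n ih =>
    rw [completeTwo, mul_add, mul_left_comm, ih]
    ring

theorem elemTwo_of_neg (x y : R) {k : ℤ} (h : k < 0) : elemTwo x y k = 0 := by
  rw [elemTwo, if_neg (by omega), if_neg (by omega), if_neg (by omega)]

theorem elemTwo_of_two_lt (x y : R) {k : ℤ} (h : 2 < k) : elemTwo x y k = 0 := by
  rw [elemTwo, if_neg (by omega), if_neg (by omega), if_neg (by omega)]

theorem det_elemTwo_one (x y : R) (n : ℕ) :
    Matrix.det (Matrix.of fun i j : Fin n => elemTwo x y (1 - (i : ℤ) + (j : ℤ))) =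
      completeTwo x y n := by
  induction n using Nat.twoStepInduction with
  | zero => simp [completeTwo]
  | one => simp [completeTwo, elemTwo]
  | more n ih0 ih1 =>
    rw [Matrix.det_succ_row_zero, Fin.sum_univ_succ, Fin.sum_univ_succ, Finset.sum_eq_zero,
      completeTwo_add_two, ← ih0, ← ih1, add_zero, sub_eq_add_neg]
    · congr 1
      · congr 1
        · simp [elemTwo]
        · congr 1
          ext1 i j
          simp only [Matrix.submatrix_apply, Matrix.of_apply, Fin.val_succ, Fin.succAbove_zero]
          exact congrArg _ (by push_cast; ring)
      · rw [Matrix.det_succ_column_zero, Finset.sum_eq_single 0]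
        · rw [← neg_mul]
          congr 1
          · simp [elemTwo]
          · simp only [Fin.val_zero, pow_zero, one_mul, Matrix.submatrix_apply, Matrix.of_apply]
            rw [Matrix.submatrix_submatrix]
            have : elemTwo x y (1 - ((Fin.succ (0 : Fin (n + 1)) : Fin (n + 2)) : ℤ) +
              (((Fin.succ (0 : Fin (n + 1))).succAbove 0 : Fin (n + 2)) : ℤ)) = 1 := by
              simp [elemTwo]
            rw [this, one_mul]
            congr 1
            ext1 i j
            simp only [Matrix.submatrix_apply, Matrix.of_apply, Function.comp_apply, Fin.val_succ,
              Fin.succ_succAbove_succ, Fin.succAbove_zero]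
            exact congrArg _ (by push_cast; ring)
        · intro i _ hi
          have hi' : 0 < (i : ℕ) := Nat.pos_of_ne_zero fun h => hi (Fin.ext h)
          have h0 : (((Fin.succ (0 : Fin (n + 1))).succAbove 0 : Fin (n + 2)) : ℕ) = 0 := by simp
          rw [Matrix.submatrix_apply, Matrix.of_apply, elemTwo_of_neg, mul_zero, zero_mul]
          rw [h0, Fin.val_succ]
          omega
        · simp
    · intro i _
      rw [Matrix.of_apply, elemTwo_of_two_lt, mul_zero, zero_mul]
      simp
      omega

theorem det_elemTwo (x y : R) (b m r : ℕ) (hr : r = b + m) (c : ℕ → ℤ) (h2 : ∀ i < b, c i = 2)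
    (h1 : ∀ i, b ≤ i → i < r → c i = 1) :
    Matrix.det (Matrix.of fun i j : Fin r => elemTwo x y (c i - (i : ℤ) + (j : ℤ))) =
      (x * y) ^ b * completeTwo x y m := by
  induction b generalizing r c with
  | zero =>
    obtain rfl : r = m := by omega
    rw [pow_zero, one_mul, ← det_elemTwo_one]
    congr 1
    ext1 i j
    rw [Matrix.of_apply, Matrix.of_apply, h1 i (Nat.zero_le _) i.2]
  | succ b ih =>
    obtain ⟨r, rfl⟩ : ∃ s, r = s + 1 := ⟨b + m, by omega⟩
    rw [Matrix.det_succ_row_zero, Fin.sum_univ_succ, Finset.sum_eq_zero, add_zero, pow_succ',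
      mul_assoc (x * y), ← ih r (by omega) (fun i => c (i + 1)) (fun i hi => h2 (i + 1) (by omega))
        (fun i hi hi' => h1 (i + 1) (by omega) (by omega))]
    · congr 1
      · simp [elemTwo, h2 0]
      · congr 1
        ext1 i j
        simp only [Matrix.submatrix_apply, Matrix.of_apply, Fin.val_succ, Fin.succAbove_zero]
        exact congrArg _ (by push_cast; ring)
    · intro i _
      rw [Matrix.of_apply, elemTwo_of_two_lt, mul_zero, zero_mul]
      simp only [Fin.val_zero, Fin.val_succ, h2 0 (Nat.succ_pos b)]
      omega

end TwoVariables

/-- The exponent `(a, b, 0, 0, …)`. -/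
def pairExponent (a b : ℕ) : ℕ →₀ ℕ := Finsupp.natCons a (Finsupp.natCons b 0)

theorem degree_pairExponent (a b : ℕ) : (pairExponent a b).degree = a + b := by
  simp [pairExponent, Finsupp.degree_natCons]

/-- Setting `x_1, x_2, …` to zero. -/
def restrictOne : MvPowerSeries ℕ ℚ →+* PowerSeries ℚ :=
  (PowerSeries.map MvPowerSeries.constantCoeff).comp expandFirst

/-- Setting `x_2, x_3, …` to zero. -/
def restrictTwo : MvPowerSeries ℕ ℚ →+* PowerSeries (PowerSeries ℚ) :=
  (PowerSeries.map restrictOne).comp expandFirst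

theorem coeff_restrictOne (f : MvPowerSeries ℕ ℚ) (b : ℕ) :
    PowerSeries.coeff b (restrictOne f) = coeff (Finsupp.natCons b 0) f := by
  rw [← coeff_coeff_expandFirst]
  rfl

theorem coeff_coeff_restrictTwo (f : MvPowerSeries ℕ ℚ) (a b : ℕ) :
    PowerSeries.coeff b (PowerSeries.coeff a (restrictTwo f)) = coeff (pairExponent a b) f := by
  rw [restrictTwo, RingHom.comp_apply, PowerSeries.coeff_map, coeff_restrictOne,
    coeff_coeff_expandFirst]
  rfl

theorem constantCoeff_elemSymm (k : ℤ) :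
    MvPowerSeries.constantCoeff (elemSymm k) = if k = 0 then 1 else 0 := by
  rw [← coeff_zero_eq_constantCoeff_apply, coeff_elemSymm]
  split_ifs with h1 h2 h2 <;> simp_all

theorem restrictOne_elemSymm (k : ℤ) : restrictOne (elemSymm k) =
    if k = 0 then 1 else if k = 1 then PowerSeries.X else 0 := by
  rw [restrictOne, RingHom.comp_apply, expandFirst_elemSymm, map_add, map_mul, PowerSeries.map_C,
    PowerSeries.map_C, PowerSeries.map_X, constantCoeff_elemSymm, constantCoeff_elemSymm]
  by_cases h0 : k = 0
  · simp [h0]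
  · by_cases h1 : k = 1
    · simp [h1]
    · simp [h0, h1, sub_eq_zero]

theorem restrictTwo_elemSymm (k : ℤ) : restrictTwo (elemSymm k) =
    elemTwo PowerSeries.X (PowerSeries.C PowerSeries.X) k := by
  rw [restrictTwo, RingHom.comp_apply, expandFirst_elemSymm, map_add, map_mul, PowerSeries.map_C,
    PowerSeries.map_C, PowerSeries.map_X, restrictOne_elemSymm, restrictOne_elemSymm, elemTwo]
  by_cases h0 : k = 0
  · simp [h0]
  · by_cases h1 : k = 1
    · simp [h1, add_comm]
    · by_cases h2 : k = 2
      · simp [h2]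
      · rw [if_neg h0, if_neg h1, if_neg (by omega), if_neg (by omega), if_neg h0, if_neg h1,
          if_neg h2]
        simp

theorem restrictTwo_schur (μ : YoungDiagram) : restrictTwo (schur μ) =
    Matrix.det (Matrix.of fun i j : Fin (μ.rowLen 0) =>
      elemTwo PowerSeries.X (PowerSeries.C PowerSeries.X)
        ((μ.colLen i : ℤ) - (i : ℤ) + (j : ℤ))) := by
  rw [schur, RingHom.map_det]
  congr 1
  ext1 i j
  exact restrictTwo_elemSymm _

theorem restrictTwo_schur_of_two_lt {μ : YoungDiagram} (h : 2 < μ.colLen 0) :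
    restrictTwo (schur μ) = 0 := by
  have h0 : 0 < μ.rowLen 0 :=
    YoungDiagram.mem_iff_lt_rowLen.1 (YoungDiagram.mem_iff_lt_colLen.2 (by omega))
  rw [restrictTwo_schur]
  refine Matrix.det_eq_zero_of_row_eq_zero ⟨0, h0⟩ fun j => ?_
  rw [Matrix.of_apply, elemTwo_of_two_lt]
  simp only [Nat.cast_zero, sub_zero]
  omega

theorem restrictTwo_schur_of_le_two {μ : YoungDiagram} (h : μ.colLen 0 ≤ 2) :
    (PowerSeries.X - PowerSeries.C PowerSeries.X) * restrictTwo (schur μ) =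
      PowerSeries.X ^ (μ.rowLen 0 + 1) * PowerSeries.C (PowerSeries.X ^ μ.rowLen 1) -
        PowerSeries.X ^ μ.rowLen 1 * PowerSeries.C (PowerSeries.X ^ (μ.rowLen 0 + 1)) := by
  have hle := μ.rowLen_anti 0 1 zero_le_one
  have hcol (i : ℕ) : μ.colLen i ≤ 2 := (μ.colLen_anti 0 i (Nat.zero_le i)).trans h
  have hrow0 (i : ℕ) : i < μ.rowLen 0 ↔ 0 < μ.colLen i := by
    rw [← YoungDiagram.mem_iff_lt_rowLen, YoungDiagram.mem_iff_lt_colLen]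
  have hrow1 (i : ℕ) : i < μ.rowLen 1 ↔ 1 < μ.colLen i := by
    rw [← YoungDiagram.mem_iff_lt_rowLen, YoungDiagram.mem_iff_lt_colLen]
  rw [restrictTwo_schur, det_elemTwo _ _ (μ.rowLen 1) (μ.rowLen 0 - μ.rowLen 1) (μ.rowLen 0)
    (by omega) (fun i => (μ.colLen i : ℤ)), mul_left_comm, sub_mul_completeTwo]
  · obtain ⟨m, hm⟩ := Nat.exists_eq_add_of_le hle
    rw [hm, Nat.add_sub_cancel_left, map_pow, map_pow]
    ring
  · intro i hi
    have := hcol i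
    have := (hrow1 i).1 hi
    omega
  · intro i hi hi'
    have := (hrow0 i).1 hi'
    have := mt (hrow1 i).2 (not_lt.2 hi)
    omega

/-- The coefficient of `x_0 ^ (a + 1) x_1 ^ b` in `(x_0 - x_1) f`. -/
def twoRowFunctional (a b : ℕ) (f : MvPowerSeries ℕ ℚ) : ℚ :=
  coeff (pairExponent a b) f - if b = 0 then 0 else coeff (pairExponent (a + 1) (b - 1)) f

theorem coeff_sub_mul_restrictTwo (a b : ℕ) (f : MvPowerSeries ℕ ℚ) :
    PowerSeries.coeff b (PowerSeries.coeff (a + 1)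
      ((PowerSeries.X - PowerSeries.C PowerSeries.X) * restrictTwo f)) =
      twoRowFunctional a b f := by
  rw [sub_mul, map_sub, map_sub, PowerSeries.coeff_succ_X_mul, PowerSeries.coeff_C_mul,
    coeff_coeff_restrictTwo, twoRowFunctional]
  congr 1
  cases b with
  | zero => rw [PowerSeries.coeff_zero_X_mul, if_pos rfl]
  | succ b =>
    rw [PowerSeries.coeff_succ_X_mul, coeff_coeff_restrictTwo, if_neg (Nat.succ_ne_zero b),
      Nat.add_sub_cancel]

theorem eq_of_rowLen_eq_of_colLen_le_two {μ ν : YoungDiagram} (hμ : μ.colLen 0 ≤ 2)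
    (hν : ν.colLen 0 ≤ 2) (h0 : μ.rowLen 0 = ν.rowLen 0) (h1 : μ.rowLen 1 = ν.rowLen 1) :
    μ = ν := by
  have hz {μ : YoungDiagram} (hμ : μ.colLen 0 ≤ 2) (i : ℕ) : μ.rowLen (i + 2) = 0 := by
    by_contra h
    have := YoungDiagram.mem_iff_lt_colLen.1
      (YoungDiagram.mem_iff_lt_rowLen.2 (Nat.pos_of_ne_zero h))
    omega
  refine YoungDiagram.rowLen_injective (funext fun i => ?_)
  match i with
  | 0 => exact h0
  | 1 => exact h1
  | i + 2 => rw [hz hμ, hz hν]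

open Classical in
theorem twoRowFunctional_schur {ν : YoungDiagram} (hν : ν.colLen 0 ≤ 2) (μ : YoungDiagram) :
    twoRowFunctional (ν.rowLen 0) (ν.rowLen 1) (schur μ) = if μ = ν then 1 else 0 := by
  rw [← coeff_sub_mul_restrictTwo]
  by_cases hμ : μ.colLen 0 ≤ 2
  · have hle := ν.rowLen_anti 0 1 zero_le_one
    have hle' := μ.rowLen_anti 0 1 zero_le_one
    rw [restrictTwo_schur_of_le_two hμ, map_sub, map_sub, PowerSeries.coeff_mul_C,
      PowerSeries.coeff_mul_C, PowerSeries.coeff_X_pow, PowerSeries.coeff_X_pow, ite_mul,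
      ite_mul, one_mul, one_mul, zero_mul, zero_mul]
    have h2 : (PowerSeries.coeff (ν.rowLen 1)) (if ν.rowLen 0 + 1 = μ.rowLen 1 then
        (PowerSeries.X ^ (μ.rowLen 0 + 1) : PowerSeries ℚ) else 0) = 0 := by
      split_ifs
      · rw [PowerSeries.coeff_X_pow, if_neg (by omega)]
      · exact map_zero _
    rw [h2, sub_zero]
    split_ifs with h0 h h
    · rw [h, PowerSeries.coeff_X_pow, if_pos rfl]
    · rw [PowerSeries.coeff_X_pow, if_neg]
      exact fun h1 => h (eq_of_rowLen_eq_of_colLen_le_two hμ hν (by omega) h1.symm)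
    · exact absurd (by rw [h]) h0
    · exact map_zero _
  · rw [restrictTwo_schur_of_two_lt (not_le.1 hμ), if_neg (by rintro rfl; exact hμ hν)]
    simp

theorem card_of_colLen_le_two {ν : YoungDiagram} (hν : ν.colLen 0 ≤ 2) :
    ν.card = ν.rowLen 0 + ν.rowLen 1 := by
  rw [← YoungDiagram.sum_rowLen (n := 2), Finset.sum_range_succ, Finset.sum_range_one]
  intro i hi
  by_contra h
  have := YoungDiagram.mem_iff_lt_colLen.1
    (YoungDiagram.mem_iff_lt_rowLen.2 (Nat.pos_of_ne_zero h))
  omega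

theorem HasSchurExpansion.coeff_eq_twoRowFunctional {f : MvPowerSeries ℕ ℚ} {c : YoungDiagram → ℚ}
    (h : HasSchurExpansion f c) {ν : YoungDiagram} (hν : ν.colLen 0 ≤ 2) :
    c ν = twoRowFunctional (ν.rowLen 0) (ν.rowLen 1) f := by
  classical
  have h1 : twoRowFunctional (ν.rowLen 0) (ν.rowLen 1) f =
      twoRowFunctional (ν.rowLen 0) (ν.rowLen 1) (homogeneousComponent ν.card f) := by
    rw [twoRowFunctional, twoRowFunctional, coeff_homogeneousComponent, degree_pairExponent,
      if_pos (card_of_colLen_le_two hν).symm]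
    congr 1
    split_ifs with h0
    · rfl
    · rw [coeff_homogeneousComponent, degree_pairExponent, if_pos]
      rw [card_of_colLen_le_two hν]
      omega
  have h2 (s : Finset YoungDiagram) (a b : ℕ) : twoRowFunctional a b (∑ μ ∈ s, c μ • schur μ) =
      ∑ μ ∈ s, c μ * twoRowFunctional a b (schur μ) := by
    have h3 (d : ℕ →₀ ℕ) : coeff d (∑ μ ∈ s, c μ • schur μ) =
        ∑ μ ∈ s, c μ * coeff d (schur μ) := by
      rw [map_sum]
      rfl
    simp only [twoRowFunctional, h3]
    split_ifs <;> simp [mul_sub]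
  rw [h1, h, h2]
  simp_rw [twoRowFunctional_schur hν]
  simp

/-! ## The multicoloring series of a graph -/

namespace SimpleGraph

section

variable {V : Type*} (G : SimpleGraph V)

/-- The number of independent sets with `j` elements. -/
def indepCount (j : ℕ) : ℚ := (Nat.card {s : Finset V // G.IsNIndepSet j s} : ℚ)

theorem indepCount_nonneg (j : ℕ) : 0 ≤ G.indepCount j := Nat.cast_nonneg _

theorem indepCount_zero : G.indepCount 0 = 1 := by
  have : Unique {s : Finset V // G.IsNIndepSet 0 s} :=
    { default := ⟨∅, ⟨by simp [IsIndepSet], rfl⟩⟩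
      uniq := fun s => Subtype.ext (Finset.card_eq_zero.1 s.2.card_eq) }
  rw [indepCount, Nat.card_unique, Nat.cast_one]

end

variable {V : Type*} [Fintype V] (G : SimpleGraph V)

theorem indepCount_of_lt {j : ℕ} (h : G.indepNum < j) : G.indepCount j = 0 := by
  have : IsEmpty {s : Finset V // G.IsNIndepSet j s} := by
    refine ⟨fun s => ?_⟩
    have := s.2.isIndepSet.card_le_indepNum
    rw [s.2.card_eq] at this
    omega
  rw [indepCount, Nat.card_of_isEmpty, Nat.cast_zero]

theorem indepCount_pos {j : ℕ} (h : j ≤ G.indepNum) : 0 < G.indepCount j := by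
  obtain ⟨s, hs⟩ := G.exists_isNIndepSet_indepNum
  obtain ⟨t, hts, ht⟩ := Finset.exists_subset_card_eq (hs.card_eq.symm ▸ h)
  have : Nonempty {s : Finset V // G.IsNIndepSet j s} :=
    ⟨⟨t, ⟨hs.isIndepSet.mono (by exact_mod_cast hts), ht⟩⟩⟩
  exact Nat.cast_pos.2 Nat.card_pos

theorem coeff_indepPoly (j : ℕ) : G.indepPoly.coeff j = G.indepCount j := by
  rw [indepPoly, Polynomial.finsetSum_coeff]
  simp_rw [Polynomial.coeff_monomial]
  rw [Finset.sum_ite_eq']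
  split_ifs with h
  · rfl
  · rw [G.indepCount_of_lt]
    simpa using h

theorem natDegree_indepPoly : G.indepPoly.natDegree = G.indepNum := by
  refine le_antisymm (Polynomial.natDegree_le_iff_coeff_eq_zero.2 fun j hj => ?_)
    (Polynomial.le_natDegree_of_ne_zero ?_)
  · rw [coeff_indepPoly, G.indepCount_of_lt hj]
  · rw [coeff_indepPoly]
    exact (G.indepCount_pos le_rfl).ne'

open Classical in
/-- A multicoloring of arbitrary type amounts to an independent set for each color. -/
def multicoloringEquiv (d : ℕ →₀ ℕ) :
    {κ : V → Finset ℕ // (∀ u v, G.Adj u v → Disjoint (κ u) (κ v)) ∧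
      ∀ i, #{v | i ∈ κ v} = d i} ≃
    ∀ i : d.support, {s : Finset V // G.IsNIndepSet (d i) s} where
  toFun κ i := ⟨Finset.univ.filter fun v => (i : ℕ) ∈ κ.1 v, by
    refine ⟨fun u hu v hv _ huv => ?_, κ.2.2 i⟩
    simp only [coe_filter, mem_univ, true_and, Set.mem_ofPred_eq] at hu hv
    exact Finset.disjoint_left.1 (κ.2.1 u v huv) hu hv⟩
  invFun S := ⟨fun v => {i ∈ d.support | ∃ h : i ∈ d.support, v ∈ (S ⟨i, h⟩).1}, by
    refine ⟨fun u v huv => Finset.disjoint_left.2 fun i hu hv => ?_, fun i => ?_⟩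
    · obtain ⟨hi, hu⟩ := (mem_filter.1 hu).2
      obtain ⟨_, hv⟩ := (mem_filter.1 hv).2
      exact (S ⟨i, hi⟩).2.isIndepSet hu hv huv.ne huv
    · by_cases hi : i ∈ d.support
      · rw [← (S ⟨i, hi⟩).2.card_eq]
        congr 1
        ext v
        simp only [mem_filter, mem_univ, true_and, hi, exists_true_left]
      · rw [Finsupp.notMem_support_iff.1 hi]
        simp [Finsupp.notMem_support_iff.1 hi]⟩
  left_inv κ := by
    apply Subtype.ext
    funext v
    ext i
    simp only [mem_filter, mem_univ, true_and, exists_prop, and_self_left, and_iff_right_iff_imp,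
      Finsupp.mem_support_iff]
    intro hi
    rw [← κ.2.2 i]
    exact Finset.card_ne_zero_of_mem (a := v) (by simpa using hi)
  right_inv S := by
    funext i
    apply Subtype.ext
    ext v
    simp only [mem_filter, mem_univ, true_and, i.2, exists_true_left]

theorem coeff_chromY (d : ℕ →₀ ℕ) : coeff d G.chromY = d.prod fun _ j => G.indepCount j := by
  classical
  let W := {κ : V → Finset ℕ // (∀ u v, G.Adj u v → Disjoint (κ u) (κ v)) ∧
      ∀ i, #{v | i ∈ κ v} = d i}
  have : Finite W := Finite.of_equiv _ (G.multicoloringEquiv d).symm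
  have : Fintype W := Fintype.ofFinite W
  have hW : (Fintype.card W : ℚ) = d.prod fun _ j => G.indepCount j := by
    rw [← Nat.card_eq_fintype_card, Nat.card_congr (G.multicoloringEquiv d), Nat.card_pi,
      Nat.cast_prod, Finsupp.prod, ← Finset.prod_coe_sort d.support]
    rfl
  let type : W → V → ℕ := fun κ v => #(κ.1 v)
  have hfib (α : V → ℕ) : coeff d (G.chromX α) = (#{κ : W | type κ = α} : ℚ) := by
    change ((Nat.card {κ : G.ProperMulticoloring α // κ.content = d} : ℕ) : ℚ) = _
    rw [← Fintype.card_subtype, ← Nat.card_eq_fintype_card]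
    congr 1
    refine Nat.card_congr
      { toFun := fun κ => ⟨⟨κ.1.1, κ.1.2.2, fun i => ?_⟩, funext κ.1.2.1⟩
        invFun := fun κ => ⟨⟨κ.1.1, fun v => congrFun κ.2 v, κ.1.2.1⟩, ?_⟩
        left_inv := fun κ => rfl
        right_inv := fun κ => rfl }
    · rw [← κ.1.content_apply, κ.2]
    · ext i
      exact (ProperMulticoloring.content_apply _ i).trans (κ.1.2.2 i)
  change ∑ᶠ α : V → ℕ, coeff d (G.chromX α) = _
  rw [finsum_eq_sum_of_support_subset (s := univ.image type), ← hW]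
  · simp_rw [hfib]
    rw [← Nat.cast_sum, ← Finset.card_eq_sum_card_fiberwise (fun κ _ =>
      mem_image_of_mem _ (mem_univ _)), Finset.card_univ]
  · intro α hα
    rw [Function.mem_support, hfib, Nat.cast_ne_zero, Finset.card_ne_zero] at hα
    obtain ⟨κ, hκ⟩ := hα
    simp only [mem_filter, mem_univ, true_and] at hκ
    exact Finset.mem_coe.2 (mem_image.2 ⟨κ, mem_univ _, hκ⟩)

theorem isSymm_chromY : G.chromY.IsSymm := by
  intro e d
  rw [coeff_chromY, coeff_chromY, Finsupp.prod_embDomain]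

theorem coeff_pairExponent_chromY (a b : ℕ) :
    coeff (pairExponent a b) G.chromY = G.indepCount a * G.indepCount b := by
  have hs : (pairExponent a b).support ⊆ range 2 := by
    intro i hi
    rw [mem_range]
    by_contra h
    obtain ⟨i, rfl⟩ := Nat.exists_eq_add_of_le' (not_lt.1 h)
    refine Finsupp.mem_support_iff.1 hi ?_
    rw [pairExponent, Finsupp.natCons_succ, Finsupp.natCons_succ]
    rfl
  rw [coeff_chromY, Finsupp.prod_of_support_subset _ hs _ fun _ _ => G.indepCount_zero,
    Finset.prod_range_succ, Finset.prod_range_one, pairExponent, Finsupp.natCons_zero,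
    Finsupp.natCons_succ, Finsupp.natCons_zero]

theorem schurCoeff_chromY {μ : YoungDiagram} (hμ : μ.colLen 0 ≤ 2) :
    schurCoeff G.chromY μ = G.indepCount (μ.rowLen 0) * G.indepCount (μ.rowLen 1) -
      if μ.rowLen 1 = 0 then 0
      else G.indepCount (μ.rowLen 0 + 1) * G.indepCount (μ.rowLen 1 - 1) := by
  rw [(hasSchurExpansion_schurCoeff G.isSymm_chromY).coeff_eq_twoRowFunctional hμ,
    twoRowFunctional, coeff_pairExponent_chromY, coeff_pairExponent_chromY]

end SimpleGraph

/-! ## Log-concavity -/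

theorem Polynomial.IsLogConcave.mul_le_mul {P : Polynomial ℚ} (hP : P.IsLogConcave)
    (hpos : ∀ j ≤ P.natDegree, 0 < P.coeff j) {i j : ℕ} (hij : i ≤ j) (hj : j + 1 ≤ P.natDegree) :
    P.coeff i * P.coeff (j + 1) ≤ P.coeff (i + 1) * P.coeff j := by
  induction j, hij using Nat.le_induction with
  | base => rw [mul_comm]
  | succ j hij ih =>
    have h1 := ih (by omega)
    have h2 := hP (j + 1) (by omega) hj
    rw [Nat.add_sub_cancel] at h2
    have hj0 := hpos j (by omega)
    have hj1 := hpos (j + 1) (by omega)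
    have hi0 := hpos i (by omega)
    refine le_of_mul_le_mul_left ?_ hj0
    calc P.coeff j * (P.coeff i * P.coeff (j + 1 + 1))
        = P.coeff i * (P.coeff j * P.coeff (j + 1 + 1)) := by ring
      _ ≤ P.coeff i * P.coeff (j + 1) ^ 2 := mul_le_mul_of_nonneg_left h2 hi0.le
      _ = P.coeff i * P.coeff (j + 1) * P.coeff (j + 1) := by ring
      _ ≤ P.coeff (i + 1) * P.coeff j * P.coeff (j + 1) := mul_le_mul_of_nonneg_right h1 hj1.le
      _ = P.coeff j * (P.coeff (i + 1) * P.coeff (j + 1)) := by ring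

theorem Polynomial.IsLogConcave.isStronglyLogConcave {P : Polynomial ℚ} (hP : P.IsLogConcave)
    (hpos : ∀ j ≤ P.natDegree, 0 < P.coeff j) : P.IsStronglyLogConcave := by
  have key (t : ℕ) : ∀ p n : ℕ, p + t ≤ n → n + t ≤ P.natDegree →
      P.coeff p * P.coeff (n + t) ≤ P.coeff (p + t) * P.coeff n := by
    induction t with
    | zero => intro p n _ _; exact le_rfl
    | succ t ih =>
      intro p n hpn hn
      refine (hP.mul_le_mul hpos (i := p) (j := n + t) (by omega) hn).trans ?_
      have := ih (p + 1) n (by omega) (by omega)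
      rwa [show p + 1 + t = p + (t + 1) by omega] at this
  intro p m n q hpm hmn hnq hq h
  obtain ⟨t, rfl⟩ := Nat.exists_eq_add_of_lt hpm
  obtain rfl : q = n + (t + 1) := by omega
  exact key (t + 1) p n (by omega) hq

theorem rowLen_twoRowSquare (k : ℕ) (i : ℕ) :
    (twoRowSquare k).rowLen i = if i < 2 then k else 0 := by
  refine eq_of_forall_lt_iff fun j => ?_
  rw [← YoungDiagram.mem_iff_lt_rowLen, twoRowSquare, YoungDiagram.mem_ofRowLens]
  match i with
  | 0 => simp
  | 1 => simp
  | i + 2 => simp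

theorem colLen_twoRowSquare_le (k : ℕ) : (twoRowSquare k).colLen 0 ≤ 2 := by
  by_contra h
  have := YoungDiagram.mem_iff_lt_rowLen.1 (YoungDiagram.mem_iff_lt_colLen.2 (not_le.1 h))
  rw [rowLen_twoRowSquare, if_neg (lt_irrefl 2)] at this
  exact absurd this (lt_irrefl 0)

end

theorem mainTheorem2 {V : Type*} [Fintype V] (G : SimpleGraph V) :
    (∃! c : YoungDiagram → ℚ, HasSchurExpansion G.chromY c) ∧
    List.TFAE [
      TwoSchurPositive G.chromY,
      ∀ k : ℕ, 1 ≤ k → 0 ≤ schurCoeff G.chromY (twoRowSquare k),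
      G.indepPoly.IsLogConcave,
      G.indepPoly.IsStronglyLogConcave] := by
  refine ⟨existsUnique_hasSchurExpansion G.isSymm_chromY, ?_⟩
  tfae_have 1 → 2 := fun h k _ => h _ (colLen_twoRowSquare_le k)
  tfae_have 2 → 3 := by
    intro h j hj _
    have := h j hj
    rw [G.schurCoeff_chromY (colLen_twoRowSquare_le j), rowLen_twoRowSquare, rowLen_twoRowSquare,
      if_pos zero_lt_two, if_pos one_lt_two, if_neg (by omega)] at this
    rw [G.coeff_indepPoly, G.coeff_indepPoly, G.coeff_indepPoly]
    linarith
  tfae_have 3 → 4 := fun h => h.isStronglyLogConcave fun j hj => by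
    rw [G.coeff_indepPoly]
    exact G.indepCount_pos (G.natDegree_indepPoly ▸ hj)
  tfae_have 4 → 1 := by
    intro h μ hμ
    rw [G.schurCoeff_chromY hμ, sub_nonneg]
    have hnonneg := mul_nonneg (G.indepCount_nonneg (μ.rowLen 0)) (G.indepCount_nonneg (μ.rowLen 1))
    have hle := μ.rowLen_anti 0 1 zero_le_one
    split_ifs with h0
    · exact hnonneg
    · by_cases hd : μ.rowLen 0 + 1 ≤ G.indepPoly.natDegree
      · have := h (μ.rowLen 1 - 1) (μ.rowLen 1) (μ.rowLen 0) (μ.rowLen 0 + 1) (by omega) hle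
          (by omega) hd (by omega)
        simp only [G.coeff_indepPoly] at this
        linarith
      · rw [G.indepCount_of_lt (j := μ.rowLen 0 + 1), zero_mul]
        · exact hnonneg
        · rw [← G.natDegree_indepPoly]
          omega
  tfae_finish
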